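/- Theorem 5.6. Let $G$ be a discrete group. Let $Z^2(G,\mathbb{T})$ be the group of normalized 2-cocycles on $G$, i.e. maps $u:G\times G\to\mathbb{T}$ with $u(x,y)u(xy,z)=u(y,z)u(x,yz)$ and $u(x,e)=u(e,x)=1$ for all $x,y,z\in G$, let $B^2(G,\mathbb{T})$ be its subgroup of coboundaries $(x,y)\mapsto\rho(x)\rho(y)\overline{\rho(xy)}$ with $\rho:G\to\mathbb{T}$, $\rho(e)=1$, and let $H^2(G,\mathbb{T})=Z^2(G,\mathbb{T})/B^2(G,\mathbb{T})$. For each $i\in\mathbb{N}$ let $\mathcal{H}_i$ be a complex Hilbert space and $\alpha_i$ an action of $G$ by $*$-automorphisms of $B(\mathcal{H}_i)$ of the form $\alpha_{i,g}=\mathrm{Ad}\,U_i(g)$, where $U_i$ is a projective unitary representation of $G$ on $\mathcal{H}_i$ with associated 2-cocycle $u_i\in Z^2(G,\mathbb{T})$, i.e. each $U_i(x)$ is unitary and $U_i(x)U_i(y)=u_i(x,y)U_i(xy)$ for all $x,y\in G$. Assume that all the classes $[u_i]$ are equal to one and the same element $[u]\neq 1$ of $H^2(G,\mathbb{T})$.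 Let $\phi_i\in\mathcal{H}_i$ be arbitrary unit vectors. Let $\mathcal{H}^\phi=\bigotimes_i^{\phi}\mathcal{H}_i$ be the infinite tensor product Hilbert space along $\phi=(\phi_i)$, i.e. the Hilbert space in which the elementary decomposable vectors $\otimes_i\psi_i$ ($\psi_i\in\mathcal{H}_i$, $\psi_i=\phi_i$ for all but finitely many $i$) are total and satisfy $(\otimes_i\psi_i,\otimes_i\xi_i)=\prod_i(\psi_i,\xi_i)$. Let $\bigotimes_i(B(\mathcal{H}_i),\phi_i)$ be the von Neumann algebra on $\mathcal{H}^\phi$ generated by the operators $\otimes_iT_i$ with $T_i\in B(\mathcal{H}_i)$ and $T_i=I_i$ for all but finitely many $i$, and let $\odot_i B(\mathcal{H}_i)$ be the $*$-algebra generated by these operators, on which $G$ acts by $(\odot_i\alpha_i)_g(\otimes_iT_i)=\otimes_i\alpha_{i,g}(T_i)$. Then $\odot_i\alpha_i$ does not extend to an action of $G$ on $\bigotimes_i(B(\mathcal{H}_i),\phi_i)$: there is no homomorphism $\beta$ from $G$ to the group of $*$-automorphisms of $\bigotimes_i(B(\mathcal{H}_i),\phi_i)$ such that $\beta_g(\otimes_iT_i)=\otimes_i\alpha_{i,g}(T_i)$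 for all $g\in G$ and all $T_i\in B(\mathcal{H}_i)$ with $T_i=I_i$ for all but finitely many $i$. -/

import Mathlib

open scoped ComplexOrder InnerProductSpace

/-! ### Normalized circle-valued 2-cocycles and the second cohomology group -/

/-- `Z²(G, 𝕋)`: the abelian group (under pointwise product) of normalized 2-cocycles on the
discrete group `G` with values in the circle group. -/
def Z2 (G : Type*) [Group G] : Subgroup (G → G → Circle) where
  carrier := {u | (∀ x y z, u x y * u (x * y) z = u y z * u x (y * z)) ∧
    ∀ x, u x 1 = 1 ∧ u 1 x = 1}
  one_mem' := by simp
  mul_mem' := by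
    rintro u v ⟨hu, hu'⟩ ⟨hv, hv'⟩
    refine ⟨fun x y z => ?_, fun x => by simp [hu', hv']⟩
    simp only [Pi.mul_apply]
    rw [mul_mul_mul_comm, hu, hv, mul_mul_mul_comm]
  inv_mem' := by
    rintro u ⟨hu, hu'⟩
    refine ⟨fun x y z => ?_, fun x => by simp [hu']⟩
    simp only [Pi.inv_apply]
    rw [← mul_inv, hu, mul_inv]

/-- `B²(G, 𝕋)`: the subgroup of coboundaries `dρ(x, y) = ρ(x) ρ(y) conj (ρ(xy))`, `ρ(e) = 1`
(complex conjugation on the circle is inversion). -/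
def B2 (G : Type*) [Group G] : Subgroup (Z2 G) where
  carrier := {v | ∃ ρ : G → Circle, ρ 1 = 1 ∧
    ∀ x y, (v : G → G → Circle) x y = ρ x * ρ y * (ρ (x * y))⁻¹}
  one_mem' := ⟨1, by simp⟩
  mul_mem' := by
    rintro u v ⟨ρ, h1, h⟩ ⟨σ, h1', h'⟩
    refine ⟨ρ * σ, by simp [h1, h1'], fun x y => ?_⟩
    simp only [Subgroup.coe_mul, Pi.mul_apply, h, h', mul_inv]
    rw [mul_mul_mul_comm, mul_mul_mul_comm (ρ x)]
  inv_mem' := by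
    rintro u ⟨ρ, h1, h⟩
    refine ⟨ρ⁻¹, by simp [h1], fun x y => ?_⟩
    simp only [Subgroup.coe_inv, Pi.inv_apply, h, mul_inv]

/-- `H²(G, 𝕋) = Z²(G, 𝕋) / B²(G, 𝕋)`. -/
abbrev H2 (G : Type*) [Group G] : Type _ := Z2 G ⧸ B2 G

/-- A projective unitary representation of `G` on the Hilbert space `K` associated with the
2-cocycle `u`: a map into the unitary group with `U(x) U(y) = u(x, y) U(xy)`. -/
structure ProjectiveUnitaryRep {G : Type*} [Group G] (u : Z2 G) (K : Type*)
    [NormedAddCommGroup K] [InnerProductSpace ℂ K] [CompleteSpace K] where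
  toFun : G → unitary (K →L[ℂ] K)
  mul_eq : ∀ x y, (toFun x : K →L[ℂ] K) * (toFun y : K →L[ℂ] K) =
    (((u : G → G → Circle) x y : Circle) : ℂ) • (toFun (x * y) : K →L[ℂ] K)

/-! ### The infinite tensor product of Hilbert spaces along a family of unit vectors -/

namespace InfTensor

universe w v

variable {ι : Type w} {H : ι → Type v} [∀ i, NormedAddCommGroup (H i)]
  [∀ i, InnerProductSpace ℂ (H i)]

/-- Elementary families: families of vectors which agree with `φ` at all but finitely many
indices. -/
structure ElemFamily (φ : ∀ i, Metric.sphere (0 : H i) 1) : Type (max w v) where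
  val : ∀ i, H i
  finite : {i | val i ≠ φ i}.Finite

/-- The inner product of two elementary decomposable vectors, `∏ᵢ ⟪ψᵢ, ξᵢ⟫`; all but finitely
many factors are `1`. -/
noncomputable def kernel (φ : ∀ i, Metric.sphere (0 : H i) 1) (ψ ξ : ElemFamily φ) : ℂ :=
  ∏ᶠ i, ⟪ψ.1 i, ξ.1 i⟫_ℂ

lemma kernel_eq_prod (φ : ∀ i, Metric.sphere (0 : H i) 1) (ψ ξ : ElemFamily φ) (J : Finset ι)
    (hψ : ∀ i ∉ J, ψ.1 i = φ i) (hξ : ∀ i ∉ J, ξ.1 i = φ i) :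
    kernel φ ψ ξ = ∏ i ∈ J, ⟪ψ.1 i, ξ.1 i⟫_ℂ := by
  apply finprod_eq_prod_of_mulSupport_subset
  intro i hi
  by_contra hJ
  have hJ' : i ∉ J := by simpa using hJ
  apply hi
  have h1 : ‖(φ i : H i)‖ = 1 := by simp
  simp [hψ i hJ', hξ i hJ', inner_self_eq_norm_sq_to_K, h1]

/-- The Gram matrix of the `i`-th components of the elementary families, transformed by `T`. -/
noncomputable def gramAt (φ : ∀ i, Metric.sphere (0 : H i) 1) (i : ι) (T : H i →L[ℂ] H i) :
    Matrix (ElemFamily φ) (ElemFamily φ) ℂ :=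
  Matrix.of fun ψ ξ => ⟪T (ψ.1 i), T (ξ.1 i)⟫_ℂ

lemma sum_gramAt (φ : ∀ i, Metric.sphere (0 : H i) 1) (i : ι) (T : H i →L[ℂ] H i)
    (x : ElemFamily φ →₀ ℂ) :
    (x.sum fun a xa => x.sum fun b xb => star xa * gramAt φ i T a b * xb) =
      ((‖T (x.sum fun a xa => xa • a.1 i)‖ ^ 2 : ℝ) : ℂ) := by
  have h := inner_self_eq_norm_sq_to_K (𝕜 := ℂ) (T (x.sum fun a xa => xa • a.1 i))
  push_cast
  refine Eq.trans ?_ h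
  simp only [Finsupp.sum, map_sum, map_smul, sum_inner, inner_sum, inner_smul_left,
    inner_smul_right, gramAt, Matrix.of_apply, Finset.mul_sum]
  rw [Finset.sum_comm]
  refine Finset.sum_congr rfl fun a _ => Finset.sum_congr rfl fun b _ => ?_
  simp only [RCLike.star_def]
  ring

lemma posSemidef_gramAt (φ : ∀ i, Metric.sphere (0 : H i) 1) (i : ι) (T : H i →L[ℂ] H i) :
    (gramAt φ i T).PosSemidef := by
  refine ⟨?_, fun x => ?_⟩
  · ext a b
    simp [gramAt, Matrix.conjTranspose_apply]
  · rw [sum_gramAt]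
    exact Complex.zero_le_real.2 (sq_nonneg _)

lemma posSemidef_gramAt_sub (φ : ∀ i, Metric.sphere (0 : H i) 1) (i : ι) (T : H i →L[ℂ] H i) :
    (((‖T‖ ^ 2 : ℝ) : ℂ) • gramAt φ i 1 - gramAt φ i T).PosSemidef := by
  refine ⟨?_, fun x => ?_⟩
  · ext a b
    simp [gramAt, Matrix.conjTranspose_apply]
  · have h : (x.sum fun a xa => x.sum fun b xb =>
        star xa * (((‖T‖ ^ 2 : ℝ) : ℂ) • gramAt φ i 1 - gramAt φ i T) a b * xb) =
        ((‖T‖ ^ 2 : ℝ) : ℂ) *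
          (x.sum fun a xa => x.sum fun b xb => star xa * gramAt φ i 1 a b * xb) -
          (x.sum fun a xa => x.sum fun b xb => star xa * gramAt φ i T a b * xb) := by
      simp only [Finsupp.sum, Finset.mul_sum, ← Finset.sum_sub_distrib]
      refine Finset.sum_congr rfl fun a _ => Finset.sum_congr rfl fun b _ => ?_
      simp only [Matrix.sub_apply, Matrix.smul_apply, smul_eq_mul]
      ring
    rw [h, sum_gramAt, sum_gramAt, ← Complex.ofReal_mul, ← Complex.ofReal_sub]
    have h2 := T.le_opNorm (x.sum fun a xa => xa • a.1 i)
    have h3 := pow_le_pow_left₀ (norm_nonneg _) h2 2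
    rw [mul_pow] at h3
    have : (0 : ℝ) ≤ ‖T‖ ^ 2 * ‖(1 : H i →L[ℂ] H i) (x.sum fun a xa => xa • a.1 i)‖ ^ 2 -
        ‖T (x.sum fun a xa => xa • a.1 i)‖ ^ 2 := by simpa using h3
    exact_mod_cast this

/-- A finite entrywise product of positive semidefinite matrices `A i ≤ B i` is positive
semidefinite, and is monotone. -/
lemma posSemidef_prod {n : Type*} (A B : ι → Matrix n n ℂ) (J : Finset ι)
    (hA : ∀ i, (A i).PosSemidef) (hAB : ∀ i, (B i - A i).PosSemidef) :
    (Matrix.of fun a b => ∏ i ∈ J, A i a b).PosSemidef ∧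
    (Matrix.of fun a b => ∏ i ∈ J, B i a b - ∏ i ∈ J, A i a b).PosSemidef := by
  classical
  induction J using Finset.induction_on with
  | empty =>
    have h0 : (Matrix.of fun _ _ : n => (0 : ℂ)).PosSemidef := Matrix.PosSemidef.zero
    refine ⟨⟨by ext a b; simp [Matrix.conjTranspose_apply], fun x => ?_⟩, by simpa using h0⟩
    have : (x.sum fun a xa => x.sum fun b xb => star xa * (1 : ℂ) * xb) =
        star (x.sum fun _ xa => xa) * (x.sum fun _ xa => xa) := by
      simp [Finsupp.sum, Finset.sum_mul_sum]
    simp only [Finset.prod_empty, Matrix.of_apply]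
    rw [this]
    exact star_mul_self_nonneg _
  | insert i J hi ih =>
    obtain ⟨h1, h2⟩ := ih
    have hB : (B i).PosSemidef := by simpa using (hAB i).add (hA i)
    refine ⟨?_, ?_⟩
    · have e : (Matrix.of fun a b => ∏ i ∈ insert i J, A i a b) =
          (A i).hadamard (Matrix.of fun a b => ∏ i ∈ J, A i a b) := by
        ext a b
        simp [Finset.prod_insert hi]
      rw [e]
      exact (hA i).hadamard h1
    · have e : (Matrix.of fun a b => ∏ i ∈ insert i J, B i a b - ∏ i ∈ insert i J, A i a b) =
          (B i).hadamard (Matrix.of fun a b => ∏ i ∈ J, B i a b - ∏ i ∈ J, A i a b) +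
          (B i - A i).hadamard (Matrix.of fun a b => ∏ i ∈ J, A i a b) := by
        ext a b
        simp [Finset.prod_insert hi]
        ring
      rw [e]
      exact (hB.hadamard h2).add ((hAB i).hadamard h1)

/-- Finite formal linear combinations of elementary families. -/
def PreSpace (φ : ∀ i, Metric.sphere (0 : H i) 1) : Type (max w v) := ElemFamily φ →₀ ℂ

noncomputable instance (φ : ∀ i, Metric.sphere (0 : H i) 1) : AddCommGroup (PreSpace φ) :=
  inferInstanceAs (AddCommGroup (ElemFamily φ →₀ ℂ))

noncomputable instance (φ : ∀ i, Metric.sphere (0 : H i) 1) : Module ℂ (PreSpace φ) :=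
  inferInstanceAs (Module ℂ (ElemFamily φ →₀ ℂ))

/-- The sesquilinear form on formal combinations given on elementary families by `kernel`. -/
noncomputable def form (φ : ∀ i, Metric.sphere (0 : H i) 1) (f g : ElemFamily φ →₀ ℂ) : ℂ :=
  f.sum fun a xa => g.sum fun b xb => star xa * kernel φ a b * xb

/-- Componentwise application to elementary families of a family of operators almost all equal to
the identity. -/
def ElemFamily.map {φ : ∀ i, Metric.sphere (0 : H i) 1} (T : ∀ i, H i →L[ℂ] H i)
    (hT : {i | T i ≠ 1}.Finite) (ψ : ElemFamily φ) : ElemFamily φ :=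
  ⟨fun i => T i (ψ.1 i), (hT.union ψ.2).subset fun i hi => by
    by_contra h
    simp only [Set.mem_union, Set.mem_ofPred_eq, not_or, not_not] at h
    exact hi (by simp [h.1, h.2])⟩

/-- A finite set of indices off which all the members of a finite set of elementary families agree
with `φ`. -/
lemma exists_finset (φ : ∀ i, Metric.sphere (0 : H i) 1) (s : Finset (ElemFamily φ)) :
    ∃ J : Finset ι, ∀ a ∈ s, ∀ i ∉ J, a.1 i = φ i := by
  classical
  refine ⟨s.biUnion fun a => a.2.toFinset, fun a ha i hi => ?_⟩
  by_contra h
  exact hi (Finset.mem_biUnion.2 ⟨a, ha, by simpa using h⟩)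

lemma form_mapDomain (φ : ∀ i, Metric.sphere (0 : H i) 1) (e : ElemFamily φ → ElemFamily φ)
    (f g : ElemFamily φ →₀ ℂ) :
    form φ (f.mapDomain e) (g.mapDomain e) =
      f.sum fun a xa => g.sum fun b xb => star xa * kernel φ (e a) (e b) * xb := by
  unfold form
  rw [Finsupp.sum_mapDomain_index]
  · refine Finsupp.sum_congr fun a _ => ?_
    rw [Finsupp.sum_mapDomain_index] <;> intros <;> ring
  · intro; simp
  · intro a x y
    simp [Finsupp.sum, ← Finset.sum_add_distrib, add_mul]

lemma norm_one_of_unit (φ : ∀ i, Metric.sphere (0 : H i) 1) (i : ι) :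
    ‖(1 : H i →L[ℂ] H i)‖ = 1 := by
  have h1 : ‖(φ i : H i)‖ = 1 := by simp
  have : Nontrivial (H i) := ⟨⟨φ i, 0, fun h => by simp [h] at h1⟩⟩
  exact norm_one

/-- Positivity of the form, and boundedness for it of the families of operators which are almost
all the identity. -/
lemma form_map_le (φ : ∀ i, Metric.sphere (0 : H i) 1) (T : ∀ i, H i →L[ℂ] H i)
    (hT : {i | T i ≠ 1}.Finite) (f : ElemFamily φ →₀ ℂ) :
    0 ≤ form φ (f.mapDomain (ElemFamily.map T hT)) (f.mapDomain (ElemFamily.map T hT)) ∧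
    form φ (f.mapDomain (ElemFamily.map T hT)) (f.mapDomain (ElemFamily.map T hT)) ≤
      ((∏ i ∈ hT.toFinset, ‖T i‖ ^ 2 : ℝ) : ℂ) * form φ f f := by
  classical
  obtain ⟨J₀, hJ₀⟩ := exists_finset φ f.support
  let J := J₀ ∪ hT.toFinset
  have hJ : ∀ a ∈ f.support, ∀ i ∉ J, a.1 i = φ i := fun a ha i hi =>
    hJ₀ a ha i fun h => hi (Finset.mem_union_left _ h)
  have hTJ : ∀ i ∉ J, T i = 1 := fun i hi => by
    by_contra h
    exact hi (Finset.mem_union_right _ (by simpa using h))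
  have hmap : ∀ a ∈ f.support, ∀ i ∉ J, (ElemFamily.map T hT a).1 i = φ i := fun a ha i hi => by
    simp [ElemFamily.map, hTJ i hi, hJ a ha i hi]
  have hprod : ∏ i ∈ hT.toFinset, ‖T i‖ ^ 2 = ∏ i ∈ J, ‖T i‖ ^ 2 := by
    refine Finset.prod_subset Finset.subset_union_right fun i _ hi => ?_
    have : T i = 1 := by simpa using hi
    rw [this, norm_one_of_unit φ, one_pow]
  obtain ⟨h1, h2⟩ := posSemidef_prod (fun i => gramAt φ i (T i))
    (fun i => ((‖T i‖ ^ 2 : ℝ) : ℂ) • gramAt φ i 1) J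
    (fun i => posSemidef_gramAt φ i (T i)) (fun i => posSemidef_gramAt_sub φ i (T i))
  have e1 : form φ (f.mapDomain (ElemFamily.map T hT)) (f.mapDomain (ElemFamily.map T hT)) =
      f.sum fun a xa => f.sum fun b xb => star xa *
        (Matrix.of fun a b => ∏ i ∈ J, gramAt φ i (T i) a b) a b * xb := by
    rw [form_mapDomain]
    refine Finsupp.sum_congr fun a ha => Finsupp.sum_congr fun b hb => ?_
    rw [kernel_eq_prod φ _ _ J (hmap a ha) (hmap b hb)]
    rfl
  have e2 : ((∏ i ∈ J, ‖T i‖ ^ 2 : ℝ) : ℂ) * form φ f f =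
      f.sum fun a xa => f.sum fun b xb => star xa *
        (∏ i ∈ J, (((‖T i‖ ^ 2 : ℝ) : ℂ) • gramAt φ i 1) a b) * xb := by
    unfold form
    simp only [Finsupp.sum, Finset.mul_sum]
    refine Finset.sum_congr rfl fun a ha => Finset.sum_congr rfl fun b hb => ?_
    rw [kernel_eq_prod φ _ _ J (hJ a ha) (hJ b hb)]
    have h1 : ∀ i, (((‖T i‖ ^ 2 : ℝ) : ℂ) • gramAt φ i 1) a b =
        ((‖T i‖ ^ 2 : ℝ) : ℂ) * ⟪a.1 i, b.1 i⟫_ℂ := fun i => rfl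
    simp only [h1, Finset.prod_mul_distrib]
    push_cast
    ring
  refine ⟨by rw [e1]; exact h1.2 f, ?_⟩
  rw [hprod, e1, e2, ← sub_nonneg]
  have := h2.2 f
  simpa only [Finsupp.sum, ← Finset.sum_sub_distrib, Matrix.of_apply, mul_sub, sub_mul] using this

lemma form_conj_symm (φ : ∀ i, Metric.sphere (0 : H i) 1) (f g : ElemFamily φ →₀ ℂ) :
    star (form φ g f) = form φ f g := by
  classical
  simp only [form, Finsupp.sum, star_sum, star_mul, star_star]
  rw [Finset.sum_comm]
  refine Finset.sum_congr rfl fun a _ => Finset.sum_congr rfl fun b _ => ?_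
  obtain ⟨J, hJ⟩ := exists_finset φ (insert a (Singleton.singleton b))
  rw [kernel_eq_prod φ b a J (hJ b (by simp)) (hJ a (by simp)),
    kernel_eq_prod φ a b J (hJ a (by simp)) (hJ b (by simp)), ← starRingEnd_apply (∏ i ∈ J, _),
    map_prod]
  simp only [inner_conj_symm]
  ring

lemma form_self_nonneg (φ : ∀ i, Metric.sphere (0 : H i) 1) (f : ElemFamily φ →₀ ℂ) :
    0 ≤ form φ f f := by
  have h := (form_map_le φ (fun _ => 1) (by simp) f).1
  have e : (ElemFamily.map (φ := φ) (fun _ => 1) (by simp)) = id := rfl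
  rwa [e, Finsupp.mapDomain_id] at h

lemma form_add_left (φ : ∀ i, Metric.sphere (0 : H i) 1) (f g h : ElemFamily φ →₀ ℂ) :
    form φ (f + g) h = form φ f h + form φ g h := by
  refine Finsupp.sum_add_index' (fun a => ?_) fun a x y => ?_
  · simp [Finsupp.sum]
  · simp [Finsupp.sum, ← Finset.sum_add_distrib, add_mul]

lemma form_smul_left (φ : ∀ i, Metric.sphere (0 : H i) 1) (r : ℂ) (f g : ElemFamily φ →₀ ℂ) :
    form φ (r • f) g = star r * form φ f g := by
  refine (Finsupp.sum_smul_index fun a => ?_).trans ?_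
  · simp [Finsupp.sum]
  · simp [form, Finsupp.sum, Finset.mul_sum, mul_assoc]

/-- The positive semidefinite inner product on formal combinations. -/
noncomputable abbrev preCore (φ : ∀ i, Metric.sphere (0 : H i) 1) :
    PreInnerProductSpace.Core ℂ (PreSpace φ) where
  inner f g := form φ f g
  conj_inner_symm f g := form_conj_symm φ f g
  re_inner_nonneg f := (Complex.nonneg_iff.1 (form_self_nonneg φ f)).1
  add_left f g h := form_add_left φ f g h
  smul_left f g r := form_smul_left φ r f g

noncomputable instance (φ : ∀ i, Metric.sphere (0 : H i) 1) :
    SeminormedAddCommGroup (PreSpace φ) :=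
  InnerProductSpace.Core.toSeminormedAddCommGroup (c := preCore φ)

noncomputable instance (φ : ∀ i, Metric.sphere (0 : H i) 1) :
    InnerProductSpace ℂ (PreSpace φ) :=
  InnerProductSpace.ofCore (preCore φ)

/-- The infinite tensor product Hilbert space `⨂ᵢ^φ Hᵢ` along the unit vectors `φ`: the Hausdorff
completion of the formal combinations of elementary decomposable vectors. -/
abbrev Space (φ : ∀ i, Metric.sphere (0 : H i) 1) : Type (max w v) :=
  UniformSpace.Completion (PreSpace φ)

/-- The elementary family `ψ` as a formal combination. -/
noncomputable def preElem (φ : ∀ i, Metric.sphere (0 : H i) 1) (ψ : ElemFamily φ) : PreSpace φ :=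
  (Finsupp.single ψ 1 : ElemFamily φ →₀ ℂ)

/-- The elementary decomposable vector `⨂ᵢ ψᵢ`. -/
noncomputable def elem (φ : ∀ i, Metric.sphere (0 : H i) 1) (ψ : ElemFamily φ) : Space φ :=
  UniformSpace.Completion.coe' (preElem φ ψ)

lemma inner_elem (φ : ∀ i, Metric.sphere (0 : H i) 1) (ψ ξ : ElemFamily φ) :
    ⟪elem φ ψ, elem φ ξ⟫_ℂ = ∏ᶠ i, ⟪ψ.1 i, ξ.1 i⟫_ℂ := by
  refine (UniformSpace.Completion.inner_coe (preElem φ ψ) (preElem φ ξ)).trans ?_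
  change form φ (Finsupp.single ψ 1) (Finsupp.single ξ 1) = kernel φ ψ ξ
  simp [form]

/-- The elementary decomposable vectors are total. -/
lemma span_elem_dense (φ : ∀ i, Metric.sphere (0 : H i) 1) :
    (Submodule.span ℂ (Set.range (elem φ))).topologicalClosure = ⊤ := by
  rw [← Submodule.dense_iff_topologicalClosure_eq_top]
  refine (UniformSpace.Completion.denseRange_coe (α := PreSpace φ)).mono ?_
  rintro _ ⟨f, rfl⟩
  have h : ∀ g : ElemFamily φ →₀ ℂ, UniformSpace.Completion.coe' (show PreSpace φ from g) ∈
      Submodule.span ℂ (Set.range (elem φ)) := by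
    intro g
    induction g using Finsupp.induction_linear with
    | zero =>
      have : UniformSpace.Completion.coe' (show PreSpace φ from (0 : ElemFamily φ →₀ ℂ)) =
          (0 : Space φ) := UniformSpace.Completion.coe_zero
      rw [this]
      exact zero_mem _
    | add x y hx hy =>
      have : UniformSpace.Completion.coe' (show PreSpace φ from x + y) =
          UniformSpace.Completion.coe' (show PreSpace φ from x) +
            UniformSpace.Completion.coe' (show PreSpace φ from y) :=
        UniformSpace.Completion.coe_add _ _
      rw [this]
      exact add_mem hx hy
    | single a c =>
      have : UniformSpace.Completion.coe' (show PreSpace φ from Finsupp.single a c) =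
          c • elem φ a := by
        rw [elem, ← UniformSpace.Completion.coe_smul]
        congr 1
        exact (Finsupp.smul_single_one a c).symm
      rw [this]
      exact Submodule.smul_mem _ _ (Submodule.subset_span ⟨a, rfl⟩)
  exact h f

/-- Families of bounded operators `Tᵢ` on `Hᵢ` with `Tᵢ = Iᵢ` for all but finitely many `i`. -/
structure FinOps (H : ι → Type v) [∀ i, NormedAddCommGroup (H i)] [∀ i, InnerProductSpace ℂ (H i)] :
    Type (max w v) where
  val : ∀ i, H i →L[ℂ] H i
  finite : {i | val i ≠ 1}.Finite

/-- `⨂ᵢ Tᵢ` on the dense subspace of combinations of elementary vectors. -/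
noncomputable def preTensorOp (φ : ∀ i, Metric.sphere (0 : H i) 1) (T : FinOps H) :
    PreSpace φ →L[ℂ] PreSpace φ :=
  LinearMap.mkContinuous
    (show PreSpace φ →ₗ[ℂ] PreSpace φ from
      (Finsupp.lmapDomain ℂ ℂ (ElemFamily.map T.1 T.2) :
        (ElemFamily φ →₀ ℂ) →ₗ[ℂ] (ElemFamily φ →₀ ℂ)))
    (∏ i ∈ T.2.toFinset, ‖T.1 i‖) fun f => by
      have h := (form_map_le φ T.1 T.2 f).2
      refine (sq_le_sq₀ (norm_nonneg _)
        (mul_nonneg (Finset.prod_nonneg fun _ _ => norm_nonneg _) (norm_nonneg _))).mp ?_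
      rw [mul_pow, ← Finset.prod_pow]
      have key : ∀ g : PreSpace φ, form φ g g = ((‖g‖ ^ 2 : ℝ) : ℂ) := fun g => by
        have := inner_self_eq_norm_sq_to_K (𝕜 := ℂ) g
        push_cast
        exact this
      rw [key f, ← Complex.ofReal_mul] at h
      have h' := (key _).symm.trans_le h
      exact_mod_cast h'

/-- The bounded operator `⨂ᵢ Tᵢ` on `⨂ᵢ^φ Hᵢ`, where `Tᵢ = Iᵢ` for all but finitely many `i`. -/
noncomputable def tensorOp (φ : ∀ i, Metric.sphere (0 : H i) 1) (T : FinOps H) :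
    Space φ →L[ℂ] Space φ :=
  (preTensorOp φ T).completion

/-- `(⨂ᵢ Tᵢ) (⨂ᵢ ψᵢ) = ⨂ᵢ Tᵢ ψᵢ`. -/
lemma tensorOp_elem (φ : ∀ i, Metric.sphere (0 : H i) 1) (T : FinOps H) (ψ : ElemFamily φ) :
    tensorOp φ T (elem φ ψ) = elem φ (ElemFamily.map T.1 T.2 ψ) := by
  have h : preTensorOp φ T (preElem φ ψ) = preElem φ (ElemFamily.map T.1 T.2 ψ) :=
    Finsupp.mapDomain_single
  rw [elem, elem, tensorOp, ← h]
  exact UniformSpace.Completion.map_coe (preTensorOp φ T).uniformContinuous _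

/-! ### The infinite tensor product von Neumann algebra and product actions -/

/-- The von Neumann algebra generated by a set of bounded operators: the double commutant of the
set and its adjoints. -/
noncomputable def generatedVN {K : Type*} [NormedAddCommGroup K] [InnerProductSpace ℂ K]
    [CompleteSpace K] (S : Set (K →L[ℂ] K)) : VonNeumannAlgebra K where
  toStarSubalgebra := StarSubalgebra.centralizer ℂ (StarSubalgebra.centralizer ℂ S : Set (K →L[ℂ] K))
  centralizer_centralizer' := by
    change Set.centralizer (Set.centralizer (StarSubalgebra.centralizer ℂ
        (StarSubalgebra.centralizer ℂ S : Set (K →L[ℂ] K)) : Set (K →L[ℂ] K))) =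
      (StarSubalgebra.centralizer ℂ
        (StarSubalgebra.centralizer ℂ S : Set (K →L[ℂ] K)) : Set (K →L[ℂ] K))
    rw [StarSubalgebra.coe_centralizer_centralizer, Set.centralizer_centralizer_centralizer]

lemma subset_generatedVN {K : Type*} [NormedAddCommGroup K] [InnerProductSpace ℂ K]
    [CompleteSpace K] (S : Set (K →L[ℂ] K)) {A : K →L[ℂ] K} (hA : A ∈ S) :
    A ∈ (generatedVN S).toStarSubalgebra := by
  change A ∈ (StarSubalgebra.centralizer ℂ (StarSubalgebra.centralizer ℂ S : Set (K →L[ℂ] K)) :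
    Set (K →L[ℂ] K))
  rw [StarSubalgebra.coe_centralizer_centralizer]
  exact Set.subset_centralizer_centralizer (Or.inl hA)

/-- The von Neumann algebra `⨂ᵢ (B(Hᵢ), φᵢ)` acting on `⨂ᵢ^φ Hᵢ`, generated by the operators
`⨂ᵢ Tᵢ` with `Tᵢ ∈ B(Hᵢ)` and `Tᵢ = Iᵢ` for all but finitely many `i`. -/
noncomputable def tensorVN (φ : ∀ i, Metric.sphere (0 : H i) 1) : VonNeumannAlgebra (Space φ) :=
  generatedVN (Set.range (tensorOp φ))

/-- `⨂ᵢ Tᵢ` as an element of `⨂ᵢ (B(Hᵢ), φᵢ)`. -/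
noncomputable def tensorElt (φ : ∀ i, Metric.sphere (0 : H i) 1) (T : FinOps H) :
    (tensorVN φ).toStarSubalgebra :=
  ⟨tensorOp φ T, subset_generatedVN _ ⟨T, rfl⟩⟩

variable [∀ i, CompleteSpace (H i)]

/-- Componentwise application of `*`-automorphisms of the `B(Hᵢ)`. -/
noncomputable def FinOps.map (θ : ∀ i, (H i →L[ℂ] H i) ≃⋆ₐ[ℂ] (H i →L[ℂ] H i)) (T : FinOps H) : FinOps H :=
  ⟨fun i => θ i (T.1 i), T.2.subset fun i hi h => hi (by
    rw [h, map_one])⟩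

/-- The action `β` of `G` by `*`-automorphisms of `⨂ᵢ (B(Hᵢ), φᵢ)` extends the algebraic product
action `⊙ᵢ αᵢ`, i.e. `β_g (⨂ᵢ Tᵢ) = ⨂ᵢ α_{i,g}(Tᵢ)` whenever `Tᵢ = Iᵢ` for all but finitely many
`i`. (These operators generate, indeed span, the algebra `⊙ᵢ B(Hᵢ)`.) -/
def ExtendsProductAction {G : Type*} [Group G] (φ : ∀ i, Metric.sphere (0 : H i) 1)
    (α : ∀ i, G →* ((H i →L[ℂ] H i) ≃⋆ₐ[ℂ] (H i →L[ℂ] H i)))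
    (β : G →* ((tensorVN φ).toStarSubalgebra ≃⋆ₐ[ℂ] (tensorVN φ).toStarSubalgebra)) : Prop :=
  ∀ (g : G) (T : FinOps H), β g (tensorElt φ T) = tensorElt φ (T.map fun i => α i g)

end InfTensor

/-! Suppose `β` extends the product action. Let `P i` be the rank-one projection onto `φ i`. The
projection `Q` onto the joint fixed space of the single-leg operators of the `P i` lies in the
algebra, is nonzero because it fixes `⨂ φ i`, and is absorbed by every such operator
(`exists_ne_zero_tensorElt_single_mul`). This relation is purely algebraic, so `β g` carries it over
without any continuity of `β g`: some nonzero vector is fixed by all the single-leg operators of `α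
i g (P i)`.

A vector of the tensor product is nearly a combination of families equal to `φ` outside a finite
set, so this forces `‖α i g (P i) (φ i)‖ → 1` (`tendsto_norm_apply_of_fixed`), that is, `|⟪φ i, U i
g (φ i)⟫| → 1`. With suitable phases `l i g`, the vector `l i g • U i g (φ i)` is then
asymptotically `φ i`, so the rephased cocycles tend pointwise to `1` (`norm_cocycle_sub_one_le`).
All of them represent the one class `c`, and coboundaries are closed under pointwise limits by
compactness of `G → Circle` (`mem_B2_of_tendsto_mul_coboundary`). Hence `c = 1`, a contradiction. -/

namespace InfTensor

/-! ### Operators acting on one tensor leg -/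

section SingleLeg

universe w v

variable {ι : Type w} {H : ι → Type v} [∀ i, NormedAddCommGroup (H i)]
  [∀ i, InnerProductSpace ℂ (H i)]

open Filter Topology

/-- The family with the operator `T` at the index `i` and the identity elsewhere. -/
noncomputable def FinOps.single (i : ι) (T : H i →L[ℂ] H i) : FinOps H := by
  classical
  exact ⟨Function.update 1 i T, (Set.finite_singleton i).subset fun j hj => by
    by_contra h
    exact hj (by simp [Function.update_of_ne (by simpa using h : j ≠ i)])⟩

@[simp]
lemma FinOps.single_same (i : ι) (T : H i →L[ℂ] H i) : (FinOps.single i T).1 i = T := by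
  simp [FinOps.single]

lemma FinOps.single_of_ne {i j : ι} (h : j ≠ i) (T : H i →L[ℂ] H i) :
    (FinOps.single i T).1 j = 1 := by
  simp [FinOps.single, h]

lemma FinOps.map_single [∀ i, CompleteSpace (H i)]
    (θ : ∀ i, (H i →L[ℂ] H i) ≃⋆ₐ[ℂ] (H i →L[ℂ] H i)) (i : ι) (T : H i →L[ℂ] H i) :
    (FinOps.single i T).map θ = FinOps.single i (θ i T) := by
  have h : ((FinOps.single i T).map θ).1 = (FinOps.single i (θ i T)).1 := by
    funext j
    change θ j ((FinOps.single i T).1 j) = _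
    by_cases hj : j = i
    · subst hj
      simp
    · rw [FinOps.single_of_ne hj, FinOps.single_of_ne hj, map_one]
  cases hS : (FinOps.single i T).map θ
  cases hS' : FinOps.single i (θ i T)
  simp_all

lemma form_self_eq (φ : ∀ i, Metric.sphere (0 : H i) 1) (f : PreSpace φ) :
    form φ f f = ((‖f‖ ^ 2 : ℝ) : ℂ) := by
  have := inner_self_eq_norm_sq_to_K (𝕜 := ℂ) f
  push_cast
  exact this

lemma norm_tensorOp_le (φ : ∀ i, Metric.sphere (0 : H i) 1) (T : FinOps H) :
    ‖tensorOp φ T‖ ≤ ∏ i ∈ T.2.toFinset, ‖T.1 i‖ := by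
  have h0 : 0 ≤ ∏ i ∈ T.2.toFinset, ‖T.1 i‖ := Finset.prod_nonneg fun _ _ => norm_nonneg _
  refine ContinuousLinearMap.opNorm_le_bound _ h0 fun x => ?_
  induction x using UniformSpace.Completion.induction_on with
  | hp => exact isClosed_le (by fun_prop) (by fun_prop)
  | ih f =>
    have e : tensorOp φ T f = (preTensorOp φ T f : Space φ) :=
      UniformSpace.Completion.map_coe (preTensorOp φ T).uniformContinuous _
    rw [e, UniformSpace.Completion.norm_coe, UniformSpace.Completion.norm_coe]
    exact (preTensorOp φ T).le_of_opNorm_le (LinearMap.mkContinuous_norm_le _ h0 _) f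

lemma norm_tensorOp_single_le_one (φ : ∀ i, Metric.sphere (0 : H i) 1) (i : ι)
    (T : H i →L[ℂ] H i) (hT : ‖T‖ ≤ 1) : ‖tensorOp φ (FinOps.single i T)‖ ≤ 1 := by
  -- The product runs over the legs where the operator is not `1`, so it is empty when `T = 1`;
  -- bounding every factor by `1` covers both cases.
  refine (norm_tensorOp_le φ _).trans (Finset.prod_le_one (fun _ _ => norm_nonneg _) fun j _ => ?_)
  by_cases hj : j = i
  · subst hj
    simpa using hT
  · rw [FinOps.single_of_ne hj]
    exact ContinuousLinearMap.norm_id_le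

/-- On a formal combination of elementary vectors, an operator acting on a single leg outside the
support multiplies the norm by that of its value at the reference vector. -/
lemma exists_norm_tensorOp_single (φ : ∀ i, Metric.sphere (0 : H i) 1) (f : PreSpace φ) :
    ∃ J : Finset ι, ∀ i ∉ J, ∀ T : H i →L[ℂ] H i,
      ‖tensorOp φ (FinOps.single i T) (f : Space φ)‖ = ‖T (φ i)‖ * ‖f‖ := by
  classical
  obtain ⟨J, hJ⟩ := exists_finset φ (show ElemFamily φ →₀ ℂ from f).support
  refine ⟨J, fun i hi T => ?_⟩
  have e : tensorOp φ (FinOps.single i T) f =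
      (preTensorOp φ (FinOps.single i T) f : Space φ) :=
    UniformSpace.Completion.map_coe (preTensorOp φ _).uniformContinuous _
  rw [e, UniformSpace.Completion.norm_coe,
    ← sq_eq_sq₀ (norm_nonneg _) (mul_nonneg (norm_nonneg _) (norm_nonneg _)), mul_pow]
  -- Every family in the support equals `φ i` at the leg `i`, so each Gram entry acquires the same
  -- factor `⟪T (φ i), T (φ i)⟫`, while the legs in `J` are untouched.
  have key : form φ (preTensorOp φ (FinOps.single i T) f) (preTensorOp φ (FinOps.single i T) f) =
      ((‖T (φ i)‖ ^ 2 : ℝ) : ℂ) * form φ f f := by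
    refine (form_mapDomain φ (ElemFamily.map (FinOps.single i T).1 (FinOps.single i T).2)
      f f).trans ?_
    simp only [form, Finsupp.sum, Finset.mul_sum]
    refine Finset.sum_congr rfl fun a ha => Finset.sum_congr rfl fun b hb => ?_
    have hm : ∀ a ∈ (show ElemFamily φ →₀ ℂ from f).support, ∀ j ∉ insert i J,
        (ElemFamily.map (FinOps.single i T).1 (FinOps.single i T).2 a).1 j = φ j := by
      intro a ha j hj
      rw [Finset.mem_insert, not_or] at hj
      change (FinOps.single i T).1 j (a.1 j) = _
      rw [FinOps.single_of_ne hj.1, hJ a ha j hj.2]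
      rfl
    rw [kernel_eq_prod φ _ _ _ (hm a ha) (hm b hb), kernel_eq_prod φ _ _ J (hJ a ha) (hJ b hb),
      Finset.prod_insert hi]
    have h1 : ∀ a ∈ (show ElemFamily φ →₀ ℂ from f).support,
        (ElemFamily.map (FinOps.single i T).1 (FinOps.single i T).2 a).1 i = T (φ i) := by
      intro a ha
      change (FinOps.single i T).1 i (a.1 i) = _
      rw [FinOps.single_same, hJ a ha i hi]
    have h2 : ∀ a : ElemFamily φ, ∀ j ∈ J,
        (ElemFamily.map (FinOps.single i T).1 (FinOps.single i T).2 a).1 j = a.1 j := by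
      intro a j hj
      change (FinOps.single i T).1 j (a.1 j) = _
      rw [FinOps.single_of_ne (show j ≠ i by rintro rfl; exact hi hj)]
      rfl
    rw [h1 a ha, h1 b hb, inner_self_eq_norm_sq_to_K,
      Finset.prod_congr rfl fun j hj => by rw [h2 a j hj, h2 b j hj]]
    push_cast
    simp only [Complex.coe_algebraMap]
    ring
  rw [form_self_eq, form_self_eq] at key
  exact_mod_cast key

/-- If a nonzero vector is fixed by contractions `Tᵢ` acting on the single legs, then
`‖Tᵢ φᵢ‖ → 1`. -/
lemma tendsto_norm_apply_of_fixed (φ : ∀ i, Metric.sphere (0 : H i) 1)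
    (T : ∀ i, H i →L[ℂ] H i) (hT : ∀ i, ‖T i‖ ≤ 1) (η : Space φ) (hη : η ≠ 0)
    (hfix : ∀ i, tensorOp φ (FinOps.single i (T i)) η = η) :
    Tendsto (fun i => ‖T i (φ i)‖) cofinite (𝓝 1) := by
  have hle : ∀ i, ‖T i (φ i)‖ ≤ 1 := fun i => by
    simpa using (T i).le_of_opNorm_le (hT i) (φ i : H i)
  have hη' : 0 < ‖η‖ := norm_pos_iff.2 hη
  refine tendsto_order.2 ⟨fun a ha => ?_, fun a ha => .of_forall fun i => (hle i).trans_lt ha⟩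
  -- One `ε` pays for replacing `η` by `f` under the contraction, the other for `‖f‖ < ‖η‖ + ε`;
  -- together `‖T i (φ i)‖ * ‖η‖ > ‖η‖ - 2 * ε > a * ‖η‖`.
  obtain ⟨ε, hε, hεa⟩ : ∃ ε > 0, 2 * ε < (1 - a) * ‖η‖ :=
    ⟨(1 - a) * ‖η‖ / 4, by have := mul_pos (sub_pos.2 ha) hη'; linarith, by
      have := mul_pos (sub_pos.2 ha) hη'; linarith⟩
  obtain ⟨f, hf⟩ := UniformSpace.Completion.denseRange_coe.exists_dist_lt η hε
  obtain ⟨J, hJ⟩ := exists_norm_tensorOp_single φ f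
  refine (J.finite_toSet.subset fun i hi => ?_)
  by_contra hiJ
  apply hi
  rw [dist_eq_norm] at hf
  have h1 := hJ i (by simpa using hiJ) (T i)
  have h2 : ‖tensorOp φ (FinOps.single i (T i)) (η - (f : Space φ))‖ ≤ ‖η - (f : Space φ)‖ := by
    simpa using ContinuousLinearMap.le_of_opNorm_le _
      (norm_tensorOp_single_le_one φ i (T i) (hT i)) (η - (f : Space φ))
  rw [map_sub, hfix] at h2
  have h3 := norm_sub_norm_le η (tensorOp φ (FinOps.single i (T i)) (f : Space φ))
  have h4 : ‖(f : Space φ)‖ - ‖η‖ ≤ ‖(f : Space φ) - η‖ := norm_sub_norm_le _ _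
  rw [norm_sub_rev, UniformSpace.Completion.norm_coe] at h4
  have h5 := hle i
  have h6 := norm_nonneg (T i (φ i))
  change a < ‖T i (φ i)‖
  rw [h1] at h3
  nlinarith

end SingleLeg

/-! ### The projection onto the joint fixed space -/

section FixedProjection

universe w v

variable {ι : Type w} {H : ι → Type v} [∀ i, NormedAddCommGroup (H i)]
  [∀ i, InnerProductSpace ℂ (H i)]

/-- If the operators `Tᵢ` fix the reference vectors, the algebra contains a nonzero element
that absorbs all the single-leg operators `Tᵢ`. -/
lemma exists_ne_zero_tensorElt_single_mul (φ : ∀ i, Metric.sphere (0 : H i) 1)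
    (T : ∀ i, H i →L[ℂ] H i) (hT : ∀ i, T i (φ i) = φ i) :
    ∃ Q : (tensorVN φ).toStarSubalgebra, Q ≠ 0 ∧
      ∀ i, tensorElt φ (FinOps.single i (T i)) * Q = Q := by
  let p : ι → (Space φ →L[ℂ] Space φ) := fun i => tensorOp φ (FinOps.single i (T i))
  let L : Submodule ℂ (Space φ) := ⨅ i, (p i - 1).ker
  have hL : ∀ x, x ∈ L ↔ ∀ i, p i x = x := fun x => by
    simp [L, Submodule.mem_iInf, sub_eq_zero]
  have hLc : IsClosed (L : Set (Space φ)) := by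
    have : (L : Set (Space φ)) = ⋂ i, {x | p i x = x} := by
      ext x
      simp [hL]
    rw [this]
    exact isClosed_iInter fun i => isClosed_eq (p i).continuous continuous_id
  have : CompleteSpace L := hLc.completeSpace_coe
  -- Operators in the commutant commute with each `p i`, hence preserve the joint fixed space `L`;
  -- this invariance puts the projection in the bicommutant.
  have hmem : L.starProjection ∈ tensorVN φ := by
    rw [VonNeumannAlgebra.IsStarProjection.mem_iff isStarProjection_starProjection]
    intro y hy
    rw [VonNeumannAlgebra.mem_commutant_iff] at hy
    rw [Submodule.range_starProjection, Module.End.mem_invtSubmodule_iff_forall_mem_of_mem]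
    intro x hx
    rw [hL] at hx ⊢
    intro i
    have h := hy (p i) (subset_generatedVN _ ⟨_, rfl⟩)
    have h' := congrArg (fun A : Space φ →L[ℂ] Space φ => A x) h
    simp only [mul_apply_eq_comp, hx i] at h'
    exact h'
  let Ω : ElemFamily φ := ⟨fun i => φ i, by simp⟩
  have hΩ : elem φ Ω ∈ L := by
    rw [hL]
    intro i
    rw [tensorOp_elem]
    congr 1
    simp only [ElemFamily.map, ElemFamily.mk.injEq, Ω]
    funext j
    by_cases hj : j = i
    · subst hj
      simp [hT]
    · simp [FinOps.single_of_ne hj]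
  have hΩ0 : elem φ Ω ≠ 0 := by
    intro h
    have h1 := inner_elem φ Ω Ω
    have h2 : ∀ i, ⟪Ω.1 i, Ω.1 i⟫_ℂ = 1 := fun i => by
      simp [Ω, inner_self_eq_norm_sq_to_K]
    rw [h, inner_zero_left, finprod_congr h2, finprod_one] at h1
    exact zero_ne_one h1
  refine ⟨⟨L.starProjection, hmem⟩, fun h => hΩ0 ?_, fun i => Subtype.ext ?_⟩
  · rw [← Submodule.starProjection_eq_self_iff.2 hΩ]
    have : L.starProjection = 0 := congrArg Subtype.val h
    simp [this]
  · ext1 x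
    exact (hL _).1 (Submodule.starProjection_apply_mem L x) i

end FixedProjection

end InfTensor

/-! ### Closedness of the coboundaries, and choice of phases -/

open Filter Topology in
/-- A coset of `B²(G, 𝕋)` whose representatives can be chosen to converge pointwise to `1` is
trivial: `B²(G, 𝕋)` is closed, being a continuous image of a compact group. -/
lemma mem_B2_of_tendsto_mul_coboundary {G : Type*} [Group G] (v : Z2 G) (u : ℕ → Z2 G)
    (hu : ∀ i, v⁻¹ * u i ∈ B2 G) (l : ℕ → G → Circle)
    (hl : ∀ x y, Tendsto (fun i => l i x * l i y * (l i (x * y))⁻¹ * (u i : G → G → Circle) x y)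
      atTop (𝓝 1)) : v ∈ B2 G := by
  choose ρ _ hρ using hu
  -- An ultrafilter limit replaces a convergent subsequence, which need not exist when `G` is
  -- uncountable.
  obtain ⟨s, -, hs⟩ := isCompact_univ.ultrafilter_le_nhds
    ((hyperfilter ℕ).map fun i => l i * ρ i) (by simp)
  have hs' : Tendsto (fun i => l i * ρ i) (hyperfilter ℕ : Filter ℕ) (𝓝 s) := hs
  have hle : (hyperfilter ℕ : Filter ℕ) ≤ atTop := Nat.hyperfilter_le_atTop
  have hsx : ∀ x, Tendsto (fun i => l i x * ρ i x) (hyperfilter ℕ : Filter ℕ) (𝓝 (s x)) :=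
    fun x => ((continuous_apply x).tendsto s).comp hs'
  -- Since `u i` is `v` times the coboundary of `ρ i`, the given sequence is `v` times the
  -- coboundary of `l i * ρ i`; its limit along the ultrafilter shows that `v` is the coboundary of
  -- `s⁻¹`.
  have key : ∀ x y, s x * s y * (s (x * y))⁻¹ * (v : G → G → Circle) x y = 1 := by
    intro x y
    refine tendsto_nhds_unique ((((hsx x).mul (hsx y)).mul (hsx (x * y)).inv).mul
      (tendsto_const_nhds (x := (v : G → G → Circle) x y)))
      (((hl x y).mono_left hle).congr fun i => ?_)
    have h : (u i : G → G → Circle) x y =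
        (v : G → G → Circle) x y * (ρ i x * ρ i y * (ρ i (x * y))⁻¹) := by
      rw [← hρ i x y]
      simp
    rw [h, mul_inv]
    simp only [mul_assoc, mul_left_comm, mul_comm]
  -- The `l i` need not be normalized at `1`; normalization of the limit comes from that of `v`.
  have h1 : s 1 = 1 := by simpa [v.2.2] using key 1 1
  refine ⟨s⁻¹, by simp [h1], fun x y => ?_⟩
  rw [eq_comm, ← inv_mul_eq_one, ← key x y]
  simp only [Pi.inv_apply, mul_inv, inv_inv, mul_comm]

lemma exists_circle_smul_eq_norm (z : ℂ) : ∃ l : Circle, (l : ℂ) * z = (‖z‖ : ℂ) := by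
  refine ⟨Circle.exp (-z.arg), ?_⟩
  have h := Complex.norm_mul_exp_arg_mul_I z
  conv_lhs => rw [← h]
  rw [Circle.coe_exp, mul_left_comm, ← Complex.exp_add]
  simp

/-! ### Projective representations and almost fixed unit vectors -/

section ProjectiveRep

variable {G : Type*} [Group G] {K : Type*} [NormedAddCommGroup K] [InnerProductSpace ℂ K]
  [CompleteSpace K] {u : Z2 G}

/-- A phase-corrected projective representation that nearly fixes a unit vector at `x`, `y` and
`xy` has a phase-corrected cocycle near `1` at `(x, y)`. -/
lemma ProjectiveUnitaryRep.norm_cocycle_sub_one_le (U : ProjectiveUnitaryRep u K) (l : G → Circle)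
    (ξ : K) (hξ : ‖ξ‖ = 1) (x y : G) :
    ‖((l x * l y * (l (x * y))⁻¹ * (u : G → G → Circle) x y : Circle) : ℂ) - 1‖ ≤
      ‖(l x : ℂ) • (U.toFun x : K →L[ℂ] K) ξ - ξ‖ + ‖(l y : ℂ) • (U.toFun y : K →L[ℂ] K) ξ - ξ‖ +
      ‖(l (x * y) : ℂ) • (U.toFun (x * y) : K →L[ℂ] K) ξ - ξ‖ := by
  set w : Circle := l x * l y * (l (x * y))⁻¹ * (u : G → G → Circle) x y with hw
  set W : G → K → K := fun g η => (l g : ℂ) • (U.toFun g : K →L[ℂ] K) η with hW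
  have hiso : ∀ g η, ‖W g η‖ = ‖η‖ := fun g η => by
    simp only [hW, norm_smul, Circle.norm_coe, one_mul]
    exact Unitary.norm_map (U.toFun g) η
  have hsub : ∀ g η ζ, W g (η - ζ) = W g η - W g ζ := fun g η ζ => by
    simp [hW, smul_sub]
  have hmul : W x (W y ξ) = (w : ℂ) • W (x * y) ξ := by
    have h := congrArg (fun A : K →L[ℂ] K => A ξ) (U.mul_eq x y)
    simp only [mul_apply_eq_comp, FunLike.coe_smul, Pi.smul_apply] at h
    have hc : w * l (x * y) = l x * l y * (u : G → G → Circle) x y := by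
      rw [hw, mul_right_comm, inv_mul_cancel_right]
    have hc' := congrArg (fun z : Circle => (z : ℂ)) hc
    simp only [Circle.coe_mul] at hc'
    simp only [hW, map_smul, h, smul_smul, hc', mul_assoc]
  -- The defects telescope through `W x (W y ξ) = w • W (x * y) ξ`; the outer `W x` and `w` preserve
  -- norms.
  have e : ((w : ℂ) - 1) • ξ =
      W x (W y ξ - ξ) + (W x ξ - ξ) - (w : ℂ) • (W (x * y) ξ - ξ) := by
    rw [hsub, hmul, smul_sub, sub_smul, one_smul]
    abel
  have h1 : ‖(w : ℂ) - 1‖ = ‖((w : ℂ) - 1) • ξ‖ := by rw [norm_smul, hξ, mul_one]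
  rw [h1, e]
  refine (norm_sub_le _ _).trans ?_
  rw [norm_smul, Circle.norm_coe, one_mul]
  refine add_le_add ((norm_add_le _ _).trans ?_) le_rfl
  rw [hiso, add_comm]

/-- The phase `l` makes the cross term in the expanded square real and nonnegative. This turns
overlaps tending to `1` into norm convergence. -/
lemma norm_smul_unitary_sub_sq (V : unitary (K →L[ℂ] K)) (ξ : K) (hξ : ‖ξ‖ = 1) (l : Circle)
    (hl : (l : ℂ) * ⟪ξ, (V : K →L[ℂ] K) ξ⟫_ℂ = (‖⟪ξ, (V : K →L[ℂ] K) ξ⟫_ℂ‖ : ℂ)) :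
    ‖(l : ℂ) • (V : K →L[ℂ] K) ξ - ξ‖ ^ 2 = 2 * (1 - ‖⟪ξ, (V : K →L[ℂ] K) ξ⟫_ℂ‖) := by
  have hV : ‖(V : K →L[ℂ] K) ξ‖ = 1 := (Unitary.norm_map V ξ).trans hξ
  rw [norm_sub_rev, norm_sub_sq (𝕜 := ℂ), inner_smul_right, hl, norm_smul, hV, hξ,
    Circle.norm_coe]
  simp
  ring

/-- Conjugating by `V` gives the projection onto the line of `V ξ`, which sends `ξ` to `⟪V ξ, ξ⟫ • V
ξ`. -/
lemma norm_conj_rankOne_apply (V : unitary (K →L[ℂ] K)) (ξ : K) (hξ : ‖ξ‖ = 1) :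
    ‖Unitary.conjStarAlgAut ℂ (K →L[ℂ] K) V (InnerProductSpace.rankOne ℂ ξ ξ) ξ‖ =
      ‖⟪ξ, (V : K →L[ℂ] K) ξ⟫_ℂ‖ := by
  rw [Unitary.conjStarAlgAut_apply]
  simp only [mul_apply_eq_comp, InnerProductSpace.rankOne_apply, map_smul, norm_smul]
  rw [show ‖(V : K →L[ℂ] K) ξ‖ = 1 from (Unitary.norm_map V ξ).trans hξ, mul_one,
    ContinuousLinearMap.star_eq_adjoint, ContinuousLinearMap.adjoint_inner_right,
    norm_inner_symm]

end ProjectiveRep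

/-! ### Asymptotic invariance of the reference vectors, and the contradiction -/

open Filter Topology in
/-- If the product action extends, the unitaries asymptotically preserve the reference vectors
up to phase. -/
lemma InfTensor.tendsto_norm_inner_of_extends {G : Type*} [Group G] {H : ℕ → Type*}
    [∀ i, NormedAddCommGroup (H i)] [∀ i, InnerProductSpace ℂ (H i)] [∀ i, CompleteSpace (H i)]
    {α : ∀ i, G →* ((H i →L[ℂ] H i) ≃⋆ₐ[ℂ] (H i →L[ℂ] H i))}
    {V : ∀ i, G → unitary (H i →L[ℂ] H i)}
    (hα : ∀ i g, α i g = Unitary.conjStarAlgAut ℂ (H i →L[ℂ] H i) (V i g))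
    (φ : ∀ i, Metric.sphere (0 : H i) 1)
    {β : G →* ((tensorVN φ).toStarSubalgebra ≃⋆ₐ[ℂ] (tensorVN φ).toStarSubalgebra)}
    (hβ : ExtendsProductAction φ α β) (g : G) :
    Tendsto (fun i => ‖⟪(φ i : H i), (V i g : H i →L[ℂ] H i) (φ i)⟫_ℂ‖) atTop (𝓝 1) := by
  have hφ : ∀ i, ‖(φ i : H i)‖ = 1 := fun i => by simp
  let P : ∀ i, H i →L[ℂ] H i := fun i => InnerProductSpace.rankOne ℂ (φ i : H i) (φ i : H i)
  obtain ⟨Q, hQ0, hQ⟩ := exists_ne_zero_tensorElt_single_mul φ P fun i => by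
    simp [P, inner_self_eq_norm_sq_to_K]
  have hfix : ∀ i, tensorElt φ (FinOps.single i (α i g (P i))) * β g Q = β g Q := fun i => by
    have h := congrArg (β g) (hQ i)
    rwa [map_mul, hβ, FinOps.map_single] at h
  have hne : (β g Q : Space φ →L[ℂ] Space φ) ≠ 0 := fun h =>
    hQ0 ((map_eq_zero_iff (β g) (β g).injective).1 (Subtype.ext h))
  -- Any nonzero vector in the range of `β g Q` is fixed by all the transported single-leg
  -- projections.
  obtain ⟨x, hx⟩ : ∃ x, (β g Q : Space φ →L[ℂ] Space φ) x ≠ 0 := by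
    by_contra! h
    exact hne (ContinuousLinearMap.ext h)
  have ht := tendsto_norm_apply_of_fixed φ (fun i => α i g (P i)) (fun i => ?_) _ hx fun i =>
    congrArg (fun A : (tensorVN φ).toStarSubalgebra => (A : Space φ →L[ℂ] Space φ) x) (hfix i)
  · rw [Nat.cofinite_eq_atTop] at ht
    refine ht.congr fun i => ?_
    rw [hα]
    exact norm_conj_rankOne_apply _ _ (hφ i)
  · rw [hα, Unitary.conjStarAlgAut_apply, ← Unitary.coe_star,
      CStarRing.norm_mul_coe_unitary, CStarRing.norm_coe_unitary_mul]
    simp [P]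

open Filter Topology in
theorem theorem5p6 {G : Type*} [Group G] {H : ℕ → Type*} [∀ i, NormedAddCommGroup (H i)]
    [∀ i, InnerProductSpace ℂ (H i)] [∀ i, CompleteSpace (H i)]
    (α : ∀ i, G →* ((H i →L[ℂ] H i) ≃⋆ₐ[ℂ] (H i →L[ℂ] H i)))
    (u : ℕ → Z2 G) (U : ∀ i, ProjectiveUnitaryRep (u i) (H i))
    (hα : ∀ i g, α i g = Unitary.conjStarAlgAut ℂ (H i →L[ℂ] H i) ((U i).toFun g))
    (c : H2 G) (hu : ∀ i, (QuotientGroup.mk (u i) : H2 G) = c) (hc : c ≠ 1)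
    (φ : ∀ i, Metric.sphere (0 : H i) 1) :
    ¬ ∃ β : G →* ((InfTensor.tensorVN φ).toStarSubalgebra ≃⋆ₐ[ℂ]
        (InfTensor.tensorVN φ).toStarSubalgebra),
      InfTensor.ExtendsProductAction φ α β := by
  rintro ⟨β, hβ⟩
  have hφ : ∀ i, ‖(φ i : H i)‖ = 1 := fun i => by simp
  choose l hl using fun i g =>
    exists_circle_smul_eq_norm ⟪(φ i : H i), ((U i).toFun g : H i →L[ℂ] H i) (φ i)⟫_ℂ
  have hd : ∀ g, Tendsto
      (fun i => ‖(l i g : ℂ) • ((U i).toFun g : H i →L[ℂ] H i) (φ i) - (φ i : H i)‖)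
      atTop (𝓝 0) := fun g => by
    have h := ((InfTensor.tendsto_norm_inner_of_extends hα φ hβ g).const_sub 1).const_mul 2
    have h' := h.sqrt
    rw [sub_self, mul_zero, Real.sqrt_zero] at h'
    refine h'.congr fun i => ?_
    rw [← norm_smul_unitary_sub_sq _ _ (hφ i) _ (hl i g), Real.sqrt_sq (norm_nonneg _)]
  -- Index `0` is an arbitrary choice of representative of `c`.
  refine hc ((hu 0).symm.trans ((QuotientGroup.eq_one_iff _).2 ?_))
  refine mem_B2_of_tendsto_mul_coboundary (u 0) u
    (fun i => QuotientGroup.eq.1 ((hu 0).trans (hu i).symm)) l fun x y => ?_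
  rw [tendsto_iff_dist_tendsto_zero]
  refine squeeze_zero (fun _ => dist_nonneg)
    (fun i => (dist_eq_norm (_ : ℂ) 1).trans_le
      ((U i).norm_cocycle_sub_one_le (l i) (φ i) (hφ i) x y)) ?_
  simpa using ((hd x).add (hd y)).add (hd (x * y))
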